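/- Graphs are undirected and may have loops and parallel edges; isomorphisms are isomorphisms of such multigraphs. A graph is \emph{toroidal} if it embeds into the torus $T^2=S^1\times S^1$, i.e. its vertices can be mapped to distinct points of $T^2$ and its edges to simple curves joining the images of their ends (simple closed curves for loops), such that the curves meet each other and the images of the vertices only at their ends. The girth of a graph is the length of a shortest cycle; loops are cycles of length one and pairs of parallel edges are cycles of length two. Let $F_{11}$ be the cubic graph with vertices $A,A',B,B',1,2,\dots,8$ and the eighteen edges $$AA',\ BB',\ A8,\ A'1,\ B5,\ B'4,\ 45,\ 18,\ A2,\ A'7,\ B3,\ B'6,\ 12,\ 34,\ 56,\ 78,\ 23,\ 67.$$ Write $F_{11}\cup e$ for any graph obtained from $F_{11}$ by adding one edge in one of the following three ways: (i) subdivide an edge once by a new vertex $u$, and add a further new vertex $v$, the edge $uv$ and a loop at $v$; (ii) subdivide an edge twice by new vertices $u$ and $v$, and add a second edge $uv$; (iii) subdivide two distinct edges $e_1,e_2$ once each, by new vertices $u$ and $v$ respectively, and add the edge $uv$; the result is denoted $F_{11}\cup(e_1-e_2)$. Put $$H_1=F_{11}\cup(AA'-18),\quad H_2=F_{11}\cup(A2-67),\quad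 H_3=F_{11}\cup(23-67),\quad H_4=F_{11}\cup(A2-B'6).$$ \textbf{Proposition.} Every graph $F_{11}\cup e$ that is not isomorphic to one of $H_1,H_2,H_3,H_4$ is toroidal. Moreover, every graph $F_{11}\cup e$ of girth at least four is isomorphic to one of the ten graphs $F_{11}\cup(e_1-e_2)$ with $(e_1,e_2)$ equal to $$(AA',BB'),\ (AA',B3),\ (AA',12),\ (AA',23),\ (AA',18),\ (A2,A'7),\ (A2,B3),\ (A2,B'6),\ (A2,67),\ (23,67).$$ -/

import Mathlib

open scoped Graph

namespace CubicTorus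

/-! Graphs are Mathlib's multigraphs `Graph α β`: loops and parallel edges are allowed, because
adding an edge to a cubic graph may create them. -/

/-- Two multigraphs are isomorphic: there are bijections between the vertices and between the edges
that preserve the relation "`x` and `y` are the ends of `e`". -/
def IsIsomorphic {α β α' β' : Type*} (G : Graph α β) (H : Graph α' β') : Prop :=
  ∃ (φ : V(G) ≃ V(H)) (ψ : E(G) ≃ E(H)), ∀ (e : E(G)) (x y : V(G)),
    G.IsLink e x y ↔ H.IsLink (ψ e) (φ x) (φ y)

/-- `G` has a cycle of length `n`, meant for `1 ≤ n`: the cyclically indexed vertices are distinct,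
so are the edges, and the `i`-th edge joins the `i`-th vertex to the next one. A cycle of length
one is a loop, a cycle of length two is a pair of parallel edges. -/
def HasCycle {α β : Type*} (G : Graph α β) (n : ℕ) : Prop :=
  ∃ (v : ZMod n → α) (ε : ZMod n → β), Function.Injective v ∧ Function.Injective ε ∧
    ∀ i, G.IsLink (ε i) (v i) (v (i + 1))

/-- The length of a shortest cycle of `G`, and `⊤` if there is none. -/
noncomputable def girth {α β : Type*} (G : Graph α β) : ℕ∞ :=
  ⨅ (n : ℕ) (_ : 1 ≤ n ∧ HasCycle G n), (n : ℕ∞)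

/-- The torus `S¹ × S¹`, with `S¹ = ℝ / ℤ`. -/
abbrev Torus : Type := UnitAddCircle × UnitAddCircle

/-- An embedding of a multigraph into a topological space: distinct vertices go to distinct points,
every edge goes to a curve that joins the images of its ends and is simple (closed if the edge is a
loop), and a curve meets the images of the vertices and the other curves only at its ends. -/
structure Embedding {α β : Type*} (G : Graph α β) (X : Type*) [TopologicalSpace X] where
  /-- the image of a vertex -/
  point : V(G) → X
  /-- the image of an edge -/
  curve : E(G) → C(unitInterval, X)
  point_injective : Function.Injective point
  curve_ends : ∀ e : E(G), ∃ x y : V(G), G.IsLink e x y ∧ curve e 0 = point x ∧ curve e 1 = point y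
  curve_injOn : ∀ e, Set.InjOn (curve e) (Set.Ioo 0 1)
  curve_ne_point : ∀ e, ∀ t ∈ Set.Ioo (0 : unitInterval) 1, ∀ x, curve e t ≠ point x
  curve_ne_curve : ∀ e e', e ≠ e' → ∀ s ∈ Set.Ioo (0 : unitInterval) 1,
    ∀ t ∈ Set.Ioo (0 : unitInterval) 1, curve e s ≠ curve e' t

/-- A graph is toroidal if it embeds into the torus. -/
def Toroidal {α β : Type*} (G : Graph α β) : Prop :=
  Nonempty (Embedding G Torus)

/-- Delete from `G` the edges in `F`, add two new vertices `Sum.inr 0` and `Sum.inr 1`, and add new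
edges, indexed by `κ`, with the ends that `f` prescribes. -/
def rebuild {α β κ : Type*} (G : Graph α β) (F : Set β) (f : κ → Sym2 (α ⊕ Fin 2)) :
    Graph (α ⊕ Fin 2) (β ⊕ κ) where
  vertexSet := Sum.inl '' V(G) ∪ Set.range Sum.inr ∪ {p | ∃ k, p ∈ f k}
  edgeSet := Sum.inl '' (E(G) \ F) ∪ Set.range Sum.inr
  IsLink ε p q := match ε with
    | Sum.inl e => e ∉ F ∧ ∃ x y, G.IsLink e x y ∧ p = Sum.inl x ∧ q = Sum.inl y
    | Sum.inr k => f k = s(p, q)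
  isLink_symm := by
    rintro (e | k) -
    · exact ⟨fun p q ⟨he, x, y, h, hp, hq⟩ => ⟨he, y, x, h.symm, hq, hp⟩⟩
    · exact ⟨fun p q h => h.trans Sym2.eq_swap⟩
  eq_or_eq_of_isLink_of_isLink := by
    rintro (e | k) p q r t
    · rintro ⟨-, x, y, h, rfl, rfl⟩ ⟨-, z, w, h', rfl, rfl⟩
      rcases h.left_eq_or_eq h' with rfl | rfl <;> simp
    · intro h h'
      have h2 : s(p, q) = s(r, t) := h.symm.trans h'
      rcases Sym2.eq_iff.1 h2 with h3 | h3
      · exact Or.inl h3.1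
      · exact Or.inr h3.1
  edge_mem_iff_exists_isLink := by
    rintro (e | k)
    · constructor
      · rintro (⟨e', ⟨he, hF⟩, h⟩ | ⟨k, h⟩)
        · obtain rfl := Sum.inl.inj h
          obtain ⟨x, y, hxy⟩ := Graph.exists_isLink_of_mem_edgeSet he
          exact ⟨_, _, hF, x, y, hxy, rfl, rfl⟩
        · cases h
      · rintro ⟨p, q, hF, x, y, h, -, -⟩
        exact Or.inl ⟨e, ⟨h.edge_mem, hF⟩, rfl⟩
    · constructor
      · intro _
        obtain ⟨p, q, h⟩ := Sym2.exists.1 (⟨f k, rfl⟩ : ∃ z, f k = z)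
        exact ⟨p, q, h⟩
      · intro _
        exact Or.inr ⟨k, rfl⟩
  left_mem_of_isLink := by
    rintro (e | k) p q
    · rintro ⟨-, x, y, h, rfl, rfl⟩
      exact Or.inl (Or.inl ⟨x, h.left_mem, rfl⟩)
    · intro h
      have h' : f k = s(p, q) := h
      exact Or.inr ⟨k, by rw [h']; exact Sym2.mem_mk_left p q⟩

section AddEdge

variable {α β : Type*} (G : Graph α β)

/-- The edge `e` with ends `x` and `y` is subdivided once by the new vertex `u`; a further vertex
`v`, the edge `uv` and a loop at `v` are added. -/
def addLoop (e : β) (x y : α) : Graph (α ⊕ Fin 2) (β ⊕ Fin 4) :=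
  let u : α ⊕ Fin 2 := Sum.inr 0
  let v : α ⊕ Fin 2 := Sum.inr 1
  rebuild G {e} ![s(Sum.inl x, u), s(u, Sum.inl y), s(u, v), s(v, v)]

/-- The edge `e` with ends `x` and `y` is subdivided twice, by the new vertices `u` and `v`, and
another edge `uv` is added. -/
def addParallel (e : β) (x y : α) : Graph (α ⊕ Fin 2) (β ⊕ Fin 4) :=
  let u : α ⊕ Fin 2 := Sum.inr 0
  let v : α ⊕ Fin 2 := Sum.inr 1
  rebuild G {e} ![s(Sum.inl x, u), s(u, v), s(v, Sum.inl y), s(u, v)]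

/-- The edge `e₁` with ends `x₁` and `y₁` is subdivided by the new vertex `u`, the edge `e₂` with
ends `x₂` and `y₂` by the new vertex `v`, and the edge `uv` is added. -/
def addChord (e₁ : β) (x₁ y₁ : α) (e₂ : β) (x₂ y₂ : α) : Graph (α ⊕ Fin 2) (β ⊕ Fin 5) :=
  let u : α ⊕ Fin 2 := Sum.inr 0
  let v : α ⊕ Fin 2 := Sum.inr 1
  rebuild G {e₁, e₂}
    ![s(Sum.inl x₁, u), s(u, Sum.inl y₁), s(Sum.inl x₂, v), s(v, Sum.inl y₂), s(u, v)]

/-- Up to isomorphism, `K` is obtained from `G` by adding one edge in one of the three ways that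
keep a cubic graph cubic. -/
def IsEdgeAddition {α' β' : Type*} (K : Graph α' β') : Prop :=
  (∃ e x y, G.IsLink e x y ∧ IsIsomorphic K (addLoop G e x y)) ∨
  (∃ e x y, G.IsLink e x y ∧ IsIsomorphic K (addParallel G e x y)) ∨
  (∃ e₁ x₁ y₁ e₂ x₂ y₂, G.IsLink e₁ x₁ y₁ ∧ G.IsLink e₂ x₂ y₂ ∧ e₁ ≠ e₂ ∧
    IsIsomorphic K (addChord G e₁ x₁ y₁ e₂ x₂ y₂))

end AddEdge

/-- The twelve vertices of `F₁₁`; `n1`, …, `n8` are those labelled by the numbers `1`, …, `8`. -/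
inductive F11Vertex
  | A | A' | B | B' | n1 | n2 | n3 | n4 | n5 | n6 | n7 | n8
  deriving DecidableEq

section F11

open F11Vertex

instance : Fintype F11Vertex where
  elems := {A, A', B, B', n1, n2, n3, n4, n5, n6, n7, n8}
  complete := by intro x; cases x <;> decide

/-- The eighteen edges of `F₁₁`. -/
def F11Edges : Finset (Sym2 F11Vertex) :=
  {s(A, A'), s(B, B'), s(A, n8), s(A', n1), s(B, n5), s(B', n4), s(n4, n5), s(n1, n8),
   s(A, n2), s(A', n7), s(B, n3), s(B', n6), s(n1, n2), s(n3, n4), s(n5, n6), s(n7, n8),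
   s(n2, n3), s(n6, n7)}

/-- The cubic projective plane obstruction `F₁₁`; its edges are labelled by their pairs of ends. -/
def F11 : Graph F11Vertex (Sym2 F11Vertex) :=
  Graph.ofSimpleGraph (SimpleGraph.fromEdgeSet (F11Edges : Set (Sym2 F11Vertex)))

/-- The graph `F₁₁ ∪ (x₁y₁ - x₂y₂)`: a new edge joins the midpoints of the edges `x₁y₁`
and `x₂y₂`. -/
def F11Chord (x₁ y₁ x₂ y₂ : F11Vertex) :
    Graph (F11Vertex ⊕ Fin 2) (Sym2 F11Vertex ⊕ Fin 5) :=
  addChord F11 s(x₁, y₁) x₁ y₁ s(x₂, y₂) x₂ y₂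

/-- `H₁ = F₁₁ ∪ (AA' - 18)`. -/
def H1 : Graph (F11Vertex ⊕ Fin 2) (Sym2 F11Vertex ⊕ Fin 5) := F11Chord A A' n1 n8

/-- `H₂ = F₁₁ ∪ (A2 - 67)`. -/
def H2 : Graph (F11Vertex ⊕ Fin 2) (Sym2 F11Vertex ⊕ Fin 5) := F11Chord A n2 n6 n7

/-- `H₃ = F₁₁ ∪ (23 - 67)`. -/
def H3 : Graph (F11Vertex ⊕ Fin 2) (Sym2 F11Vertex ⊕ Fin 5) := F11Chord n2 n3 n6 n7

/-- `H₄ = F₁₁ ∪ (A2 - B'6)`. -/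
def H4 : Graph (F11Vertex ⊕ Fin 2) (Sym2 F11Vertex ⊕ Fin 5) := F11Chord A n2 B' n6

/-- Ten graphs of the form `F₁₁ ∪ e`. -/
def F11Cases : List (Graph (F11Vertex ⊕ Fin 2) (Sym2 F11Vertex ⊕ Fin 5)) :=
  [F11Chord A A' B B', F11Chord A A' B n3, F11Chord A A' n1 n2, F11Chord A A' n2 n3,
   F11Chord A A' n1 n8, F11Chord A n2 A' n7, F11Chord A n2 B n3, F11Chord A n2 B' n6,
   F11Chord A n2 n6 n7, F11Chord n2 n3 n6 n7]

end F11

end CubicTorus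

/-!
Subdivide the torus into an `N × N` grid. Its cells, that is its vertices, open intervals and open
squares, partition the torus, so a drawing whose edges are walks in the grid is an embedding as soon
as no cell is used twice: being toroidal gets certificates that a finite computation verifies.

The graph `F₁₁` has 64 automorphisms. Up to them there are three edges, ten pairs of disjoint edges
and four pairs of edges with a common end. One drawing of `F₁₁` on the torus has a face into which
the new edge fits, for all three edges in the cases (i) and (ii) and for nine of the fourteen pairs
in the case (iii). Four of the other five pairs give `H₁`, …, `H₄`, and the last one,
`A2` and `A'7`, gives a graph isomorphic to `H₁`.

Except when the new edge joins two disjoint edges of `F₁₁`, it lies on a cycle of length at most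
three or ends at a loop.
-/

namespace CubicTorus

/-! ### Cells of the grid on the torus -/

/-- The index of the cell of the line, subdivided at the integers, that contains `x`: it is `2 * n`
for the vertex `n` and `2 * n + 1` for the open interval from `n` to `n + 1`. -/
noncomputable def cellIndex (x : ℝ) : ℤ := ⌊x⌋ + ⌈x⌉

lemma cellIndex_intCast (n : ℤ) : cellIndex n = n + n := by
  simp [cellIndex]

lemma cellIndex_add_intCast (x : ℝ) (k : ℤ) : cellIndex (x + k) = cellIndex x + 2 * k := by
  simp only [cellIndex, Int.floor_add_intCast, Int.ceil_add_intCast]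
  ring

lemma cellIndex_lineMap {a b : ℤ} (hab : |b - a| ≤ 1) {θ : ℝ} (hθ : θ ∈ Set.Ioo 0 1) :
    cellIndex (AffineMap.lineMap (a : ℝ) (b : ℝ) θ) = a + b := by
  obtain ⟨d, rfl⟩ : ∃ d, b = a + d := ⟨b - a, by ring⟩
  have hd : d = -1 ∨ d = 0 ∨ d = 1 := by
    rw [add_sub_cancel_left, abs_le] at hab
    omega
  have hceil : ⌈θ⌉ = 1 := Int.ceil_eq_iff.2 (by norm_num; exact ⟨hθ.1, hθ.2.le⟩)
  have hfloor : ⌊θ⌋ = 0 := Int.floor_eq_zero_iff.2 ⟨hθ.1.le, hθ.2⟩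
  have hshift : cellIndex (θ * d) = d := by
    rcases hd with rfl | rfl | rfl <;>
      simp [cellIndex, Int.floor_neg, Int.ceil_neg, hceil, hfloor]
  rw [AffineMap.lineMap_apply_ring', Int.cast_add, add_sub_cancel_left, cellIndex_add_intCast,
    hshift]
  ring

/-- The point of the circle, seen as the line modulo `N`, with the coordinate `x`. -/
noncomputable def circlePoint (N : ℕ) (x : ℝ) : UnitAddCircle := ((x / N : ℝ) : UnitAddCircle)

@[fun_prop]
lemma continuous_circlePoint (N : ℕ) : Continuous (circlePoint N) :=
  (AddCircle.continuous_mk' 1).comp (continuous_id.div_const _)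

lemma periodic_cellIndex_mul (N : ℕ) :
    Function.Periodic (fun x : ℝ => (cellIndex (N * x) : ZMod (2 * N))) 1 := by
  intro x
  have hperiod : cellIndex (N * (x + 1)) = cellIndex (N * x) + (2 * N : ℕ) := by
    simpa [mul_add] using cellIndex_add_intCast (N * x) N
  simp only [hperiod, Int.cast_add, Int.cast_natCast, ZMod.natCast_self, add_zero]

/-- The index of the cell that contains a point of the circle, subdivided into `N` intervals. -/
noncomputable def circleCell (N : ℕ) : UnitAddCircle → ZMod (2 * N) :=
  (periodic_cellIndex_mul N).lift

section Circle

variable {N : ℕ} [NeZero N]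

lemma circleCell_circlePoint (x : ℝ) : circleCell N (circlePoint N x) = cellIndex x := by
  rw [circleCell, circlePoint, Function.Periodic.lift_coe, mul_div_cancel₀ _ (NeZero.ne _)]

lemma circlePoint_eq_iff {x y : ℝ} :
    circlePoint N x = circlePoint N y ↔ ∃ k : ℤ, x - y = k * N := by
  rw [circlePoint, circlePoint, ← sub_eq_zero, ← AddCircle.coe_sub, AddCircle.coe_eq_zero_iff]
  refine exists_congr fun k => ?_
  rw [zsmul_eq_mul, mul_one, ← sub_div, eq_div_iff (NeZero.ne _), eq_comm]

lemma circlePoint_intCast_eq {a b : ℤ} (h : (a : ZMod N) = b) :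
    circlePoint N a = circlePoint N b := by
  obtain ⟨k, hk⟩ := (ZMod.intCast_eq_intCast_iff_dvd_sub b a N).1 h.symm
  exact circlePoint_eq_iff.2 ⟨k, by exact_mod_cast hk.trans (mul_comm _ _)⟩

lemma eq_of_circlePoint_eq {x y : ℝ} (hxy : |x - y| < 1)
    (h : circlePoint N x = circlePoint N y) : x = y := by
  obtain ⟨k, hk⟩ := circlePoint_eq_iff.1 h
  have hint : |k * (N : ℤ)| < 1 := by
    rw [hk] at hxy
    exact_mod_cast hxy
  rw [← sub_eq_zero, hk]
  exact_mod_cast Int.abs_lt_one_iff.1 hint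

end Circle

/-- The point of the torus, seen as the plane modulo `N` in both coordinates, with the given
coordinates. -/
noncomputable def torusPoint (N : ℕ) : ℝ × ℝ → Torus := Prod.map (circlePoint N) (circlePoint N)

/-- The index of the cell that contains a point of the torus, subdivided into an `N × N` grid of
vertices, open intervals and open squares. -/
noncomputable def torusCell (N : ℕ) : Torus → ZMod (2 * N) × ZMod (2 * N) :=
  Prod.map (circleCell N) (circleCell N)

/-- The point of the torus at a vertex of the `N × N` grid. -/
noncomputable def gridPoint (N : ℕ) (p : ℤ × ℤ) : Torus :=
  torusPoint N (Prod.map Int.cast Int.cast p)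

/-- The index of the cell in the middle between two equal or adjacent vertices `p` and `q` of
the grid. -/
def middleCell (N : ℕ) (p q : ℤ × ℤ) : ZMod (2 * N) × ZMod (2 * N) :=
  Prod.map Int.cast Int.cast (p + q)

lemma torusCell_gridPoint {N : ℕ} [NeZero N] (p : ℤ × ℤ) :
    torusCell N (gridPoint N p) = middleCell N p p := by
  simp [torusCell, gridPoint, torusPoint, middleCell, circleCell_circlePoint, cellIndex_intCast,
    Prod.ext_iff]

lemma torusCell_torusPoint_lineMap {N : ℕ} [NeZero N] {p q : ℤ × ℤ} (hfst : |q.1 - p.1| ≤ 1)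
    (hsnd : |q.2 - p.2| ≤ 1) {θ : ℝ} (hθ : θ ∈ Set.Ioo 0 1) :
    torusCell N (torusPoint N (AffineMap.lineMap (Prod.map Int.cast Int.cast p)
      (Prod.map Int.cast Int.cast q) θ)) = middleCell N p q := by
  simp only [torusCell, torusPoint, middleCell, Prod.ext_iff, Prod.map_fst, Prod.map_snd,
    AffineMap.fst_lineMap, AffineMap.snd_lineMap, circleCell_circlePoint,
    cellIndex_lineMap hfst hθ, cellIndex_lineMap hsnd hθ, Prod.fst_add, Prod.snd_add, and_self]

lemma gridPoint_eq {N : ℕ} [NeZero N] {p q : ℤ × ℤ}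
    (h : (Prod.map Int.cast Int.cast p : ZMod N × ZMod N) = Prod.map Int.cast Int.cast q) :
    gridPoint N p = gridPoint N q :=
  Prod.ext (circlePoint_intCast_eq (congrArg Prod.fst h))
    (circlePoint_intCast_eq (congrArg Prod.snd h))

/-! ### Polygonal curves -/

section Polyline

variable {E : Type*} [AddCommGroup E] [Module ℝ E]

/-- The piecewise linear interpolation of the points `a 0, …, a n` at the parameters `0, …, n`. -/
noncomputable def polyline (a : ℕ → E) (n : ℕ) (t : ℝ) : E :=
  a 0 + ∑ i ∈ Finset.range n, max 0 (min 1 (t - i)) • (a (i + 1) - a i)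

@[fun_prop]
lemma continuous_polyline [TopologicalSpace E] [ContinuousAdd E] [ContinuousSMul ℝ E] (a : ℕ → E)
    (n : ℕ) : Continuous (polyline a n) := by
  unfold polyline
  fun_prop

lemma polyline_eq_lineMap (a : ℕ → E) {n i : ℕ} (hi : i < n) {t : ℝ}
    (ht : t ∈ Set.Icc (i : ℝ) (i + 1)) :
    polyline a n t = AffineMap.lineMap (a i) (a (i + 1)) (t - i) := by
  have hlater : ∀ j ∈ Finset.Ico (i + 1) n, max 0 (min 1 (t - j)) • (a (j + 1) - a j) = 0 := by
    intro j hj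
    have hj : (i : ℝ) + 1 ≤ j := by exact_mod_cast (Finset.mem_Ico.1 hj).1
    rw [max_eq_left ((min_le_right _ _).trans (by linarith [ht.2])), zero_smul]
  have hearlier : ∀ j ∈ Finset.range i,
      max 0 (min 1 (t - j)) • (a (j + 1) - a j) = a (j + 1) - a j := by
    intro j hj
    have hj : (j : ℝ) + 1 ≤ i := by exact_mod_cast Finset.mem_range.1 hj
    rw [min_eq_left (by linarith [ht.1]), max_eq_right zero_le_one, one_smul]
  have hcurrent : max 0 (min 1 (t - i)) = t - i := by
    rw [min_eq_right (by linarith [ht.2]), max_eq_right (by linarith [ht.1])]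
  rw [polyline, ← Finset.sum_range_add_sum_Ico _ hi, Finset.sum_eq_zero hlater,
    Finset.sum_range_succ, Finset.sum_congr rfl hearlier, Finset.sum_range_sub, hcurrent,
    AffineMap.lineMap_apply_module']
  abel

lemma polyline_zero (a : ℕ → E) {n : ℕ} (hn : n ≠ 0) : polyline a n 0 = a 0 := by
  simpa using polyline_eq_lineMap a (t := 0) hn.bot_lt (by simp)

lemma polyline_natCast_self (a : ℕ → E) {n : ℕ} (hn : n ≠ 0) : polyline a n n = a n := by
  obtain ⟨m, rfl⟩ := Nat.exists_eq_succ_of_ne_zero hn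
  simpa using polyline_eq_lineMap a (t := (m + 1 : ℕ)) m.lt_succ_self (by simp)

end Polyline

/-! ### Curves along walks in the grid -/

/-- The unit steps of the grid. -/
inductive Step
  | right | left | up | down

/-- The displacement of a unit step. -/
def Step.vec : Step → ℤ × ℤ
  | right => (1, 0)
  | left => (-1, 0)
  | up => (0, 1)
  | down => (0, -1)

/-- The vertex of the grid reached from `p` by the first `i` steps of `w`. -/
def walk (p : ℤ × ℤ) (w : List Step) (i : ℕ) : ℤ × ℤ :=
  p + ((w.take i).map Step.vec).sum

lemma walk_zero (p : ℤ × ℤ) (w : List Step) : walk p w 0 = p := by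
  simp [walk]

lemma walk_succ (p : ℤ × ℤ) (w : List Step) {i : ℕ} (hi : i < w.length) :
    walk p w (i + 1) = walk p w i + w[i].vec := by
  rw [walk, walk, List.take_add_one, List.getElem?_eq_getElem hi, Option.toList_some,
    List.map_append, List.sum_append, List.map_singleton, List.sum_singleton, add_assoc]

lemma abs_walk_sub (p : ℤ × ℤ) (w : List Step) {i : ℕ} (hi : i < w.length) :
    |(walk p w (i + 1)).1 - (walk p w i).1| = 1 ∧ (walk p w (i + 1)).2 = (walk p w i).2 ∨
      (walk p w (i + 1)).1 = (walk p w i).1 ∧ |(walk p w (i + 1)).2 - (walk p w i).2| = 1 := by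
  rw [walk_succ p w hi]
  cases w[i] <;> simp [Step.vec]

/-- The point of the torus reached after the time `t` by running at unit speed along the walk `w`
from `p`. -/
noncomputable def walkPoint (N : ℕ) (p : ℤ × ℤ) (w : List Step) (t : ℝ) : Torus :=
  torusPoint N (polyline (fun i => Prod.map Int.cast Int.cast (walk p w i)) w.length t)

/-- The curve in the torus that runs at constant speed along the walk `w` from `p`. -/
noncomputable def walkCurve (N : ℕ) (p : ℤ × ℤ) (w : List Step) : C(unitInterval, Torus) where
  toFun t := walkPoint N p w (w.length * t)
  continuous_toFun := by
    unfold walkPoint torusPoint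
    fun_prop

/-- The cells that the walk `w` from `p` traverses, in their order: its `i`-th vertex has the
index `2 * i`, and the edge that follows it the index `2 * i + 1`. -/
def walkCell (N : ℕ) (p : ℤ × ℤ) (w : List Step) (m : ℕ) : ZMod (2 * N) × ZMod (2 * N) :=
  middleCell N (walk p w (m / 2)) (walk p w ((m + 1) / 2))

/-- The cells that the walk `w` from `p` traverses between its ends. -/
def innerCells (N : ℕ) (p : ℤ × ℤ) (w : List Step) : List (ZMod (2 * N) × ZMod (2 * N)) :=
  (List.range' 1 (2 * w.length - 1)).map (walkCell N p w)

section Walk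

variable {N : ℕ} {p : ℤ × ℤ} {w : List Step}

lemma walkPoint_eq_lineMap {i : ℕ} (hi : i < w.length) {t : ℝ}
    (ht : t ∈ Set.Icc (i : ℝ) (i + 1)) :
    walkPoint N p w t = torusPoint N (AffineMap.lineMap (Prod.map Int.cast Int.cast (walk p w i))
      (Prod.map Int.cast Int.cast (walk p w (i + 1))) (t - i)) := by
  rw [walkPoint, polyline_eq_lineMap _ hi ht]

lemma walkCurve_zero (hw : w ≠ []) : walkCurve N p w 0 = gridPoint N p := by
  simp [walkCurve, walkPoint, gridPoint, polyline_zero, hw, walk_zero]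

lemma walkCurve_one (hw : w ≠ []) : walkCurve N p w 1 = gridPoint N (walk p w w.length) := by
  simp [walkCurve, walkPoint, gridPoint, polyline_natCast_self, hw]

lemma length_mul_mem_Ioo (hw : w ≠ []) {t : unitInterval} (ht : t ∈ Set.Ioo 0 1) :
    (w.length * t : ℝ) ∈ Set.Ioo (0 : ℝ) w.length := by
  have hlength : (0 : ℝ) < w.length := by exact_mod_cast List.length_pos_iff.2 hw
  exact ⟨mul_pos hlength ht.1, mul_lt_of_lt_one_right hlength ht.2⟩

variable [NeZero N]

lemma torusCell_walkPoint {t : ℝ} (ht : t ∈ Set.Ico (0 : ℝ) w.length) :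
    torusCell N (walkPoint N p w t) = walkCell N p w (⌊t⌋₊ + ⌈t⌉₊) := by
  have hi : ⌊t⌋₊ < w.length := (Nat.floor_lt ht.1).2 ht.2
  have hle : (⌊t⌋₊ : ℝ) ≤ t := Nat.floor_le ht.1
  have hlt : t < ⌊t⌋₊ + 1 := Nat.lt_floor_add_one t
  rw [walkPoint_eq_lineMap hi ⟨hle, hlt.le⟩]
  rcases hle.eq_or_lt with heq | hlt'
  · have hceil : ⌈t⌉₊ = ⌊t⌋₊ := by conv_lhs => rw [← heq, Nat.ceil_natCast]
    rw [hceil, show t - ⌊t⌋₊ = 0 by linarith, AffineMap.lineMap_apply_zero, walkCell,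
      show (⌊t⌋₊ + ⌊t⌋₊) / 2 = ⌊t⌋₊ by omega, show (⌊t⌋₊ + ⌊t⌋₊ + 1) / 2 = ⌊t⌋₊ by omega]
    exact torusCell_gridPoint _
  · have hceil : ⌈t⌉₊ = ⌊t⌋₊ + 1 := by
      rw [Nat.ceil_eq_iff (by omega)]
      exact ⟨by simpa using hlt', by exact_mod_cast hlt.le⟩
    have hθ : t - ⌊t⌋₊ ∈ Set.Ioo (0 : ℝ) 1 := ⟨by linarith, by linarith⟩
    have hstep := abs_walk_sub p w hi
    rw [hceil, walkCell, show (⌊t⌋₊ + (⌊t⌋₊ + 1)) / 2 = ⌊t⌋₊ by omega,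
      show (⌊t⌋₊ + (⌊t⌋₊ + 1) + 1) / 2 = ⌊t⌋₊ + 1 by omega]
    refine torusCell_torusPoint_lineMap ?_ ?_ hθ <;> rcases hstep with h | h <;> simp [h]

lemma injOn_walkPoint_Ico {i : ℕ} (hi : i < w.length) :
    Set.InjOn (walkPoint N p w) (Set.Ico i (i + 1)) := by
  intro s hs t ht hst
  have hdist : |s - t| < 1 := by
    rw [abs_lt]
    constructor <;> linarith [hs.1, hs.2, ht.1, ht.2]
  have key : ∀ {a b : ℤ}, |b - a| = 1 →
      circlePoint N (AffineMap.lineMap (a : ℝ) (b : ℝ) (s - i)) =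
        circlePoint N (AffineMap.lineMap (a : ℝ) (b : ℝ) (t - i)) → s = t := by
    intro a b hab h
    have hab' : |(b : ℝ) - a| = 1 := by exact_mod_cast hab
    have hdiff : AffineMap.lineMap (a : ℝ) (b : ℝ) (s - i) -
        AffineMap.lineMap (a : ℝ) (b : ℝ) (t - i) = (s - t) * (b - a) := by
      simp only [AffineMap.lineMap_apply_ring']
      ring
    have heq := eq_of_circlePoint_eq (by rwa [hdiff, abs_mul, hab', mul_one]) h
    rw [← sub_eq_zero, hdiff, mul_eq_zero, sub_eq_zero] at heq
    exact heq.resolve_right fun h0 => by simp [h0] at hab'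
  rw [walkPoint_eq_lineMap hi ⟨hs.1, hs.2.le⟩, walkPoint_eq_lineMap hi ⟨ht.1, ht.2.le⟩] at hst
  rcases abs_walk_sub p w hi with h | h
  · exact key h.1 (by simpa [torusPoint] using congrArg Prod.fst hst)
  · exact key h.2 (by simpa [torusPoint] using congrArg Prod.snd hst)

lemma floor_add_ceil_mem_range' {n : ℕ} {t : ℝ} (ht : t ∈ Set.Ioo (0 : ℝ) n) :
    ⌊t⌋₊ + ⌈t⌉₊ ∈ List.range' 1 (2 * n - 1) := by
  have hfloor : ⌊t⌋₊ < n := (Nat.floor_lt ht.1.le).2 ht.2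
  have hceil : 0 < ⌈t⌉₊ := Nat.ceil_pos.2 ht.1
  have hceil' := Nat.ceil_le_floor_add_one t
  rw [List.mem_range'_1]
  omega

lemma torusCell_walkCurve_mem_innerCells (hw : w ≠ []) {t : unitInterval} (ht : t ∈ Set.Ioo 0 1) :
    torusCell N (walkCurve N p w t) ∈ innerCells N p w := by
  have ht := length_mul_mem_Ioo hw ht
  exact List.mem_map.2 ⟨_, floor_add_ceil_mem_range' ht,
    (torusCell_walkPoint (Set.Ioo_subset_Ico_self ht)).symm⟩

lemma injOn_walkCurve (hw : w ≠ []) (hnodup : (innerCells N p w).Nodup) :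
    Set.InjOn (walkCurve N p w) (Set.Ioo 0 1) := by
  intro s hs t ht hst
  have hs := length_mul_mem_Ioo hw hs
  have ht := length_mul_mem_Ioo hw ht
  have hcell := congrArg (torusCell N) hst
  change torusCell N (walkPoint N p w _) = torusCell N (walkPoint N p w _) at hcell
  rw [torusCell_walkPoint (Set.Ioo_subset_Ico_self hs),
    torusCell_walkPoint (Set.Ioo_subset_Ico_self ht)] at hcell
  have hindex := List.inj_on_of_nodup_map hnodup (floor_add_ceil_mem_range' hs)
    (floor_add_ceil_mem_range' ht) hcell
  have hfloor : ⌊(w.length * s : ℝ)⌋₊ = ⌊(w.length * t : ℝ)⌋₊ := by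
    have := Nat.floor_le_ceil (w.length * s : ℝ)
    have := Nat.ceil_le_floor_add_one (w.length * s : ℝ)
    have := Nat.floor_le_ceil (w.length * t : ℝ)
    have := Nat.ceil_le_floor_add_one (w.length * t : ℝ)
    omega
  have hparameter : (w.length * s : ℝ) = w.length * t :=
    injOn_walkPoint_Ico ((Nat.floor_lt ht.1.le).2 ht.2)
      ⟨hfloor ▸ Nat.floor_le hs.1.le, hfloor ▸ Nat.lt_floor_add_one _⟩
      ⟨Nat.floor_le ht.1.le, Nat.lt_floor_add_one _⟩ hst
  have hlength : (w.length : ℝ) ≠ 0 := by simpa using hw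
  exact Subtype.ext (mul_left_cancel₀ hlength hparameter)

end Walk

/-! ### Grid drawings -/

section Drawing

variable {α β : Type*}

/-- An edge, drawn as a walk in the grid from its end `src` to its end `tgt`. -/
structure Route (α β : Type*) where
  /-- the edge -/
  edge : β
  /-- its first end -/
  src : α
  /-- its second end -/
  tgt : α
  /-- the steps from the first end to the second -/
  steps : List Step

/-- Every edge of `G` is drawn by one of the routes `R`. The routes of `R` that do not belong to an
edge of `G` are harmless. -/
def Covers (R : List (Route α β)) (G : Graph α β) : Prop :=
  ∀ e ∈ E(G), ∃ r ∈ R, r.edge = e ∧ G.IsLink e r.src r.tgt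

/-- With the vertices at the grid points `p`, the routes `R` end where they should, and the vertices
and the routes use pairwise distinct cells of the `N × N` grid on the torus. -/
def IsGridDrawing (N : ℕ) (p : α → ℤ × ℤ) (R : List (Route α β)) : Prop :=
  (∀ r ∈ R, r.steps ≠ [] ∧ (Prod.map Int.cast Int.cast (walk (p r.src) r.steps r.steps.length) :
    ZMod N × ZMod N) = Prod.map Int.cast Int.cast (p r.tgt)) ∧
  Function.Injective (fun x => middleCell N (p x) (p x)) ∧
  (R.flatMap fun r => innerCells N (p r.src) r.steps).Nodup ∧
  ∀ x, middleCell N (p x) (p x) ∉ R.flatMap fun r => innerCells N (p r.src) r.steps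

instance [Fintype α] [DecidableEq α] (N : ℕ) (p : α → ℤ × ℤ) (R : List (Route α β)) :
    Decidable (IsGridDrawing N p R) :=
  inferInstanceAs (Decidable (_ ∧ _ ∧ _ ∧ _))

theorem toroidal_of_isGridDrawing {G : Graph α β} {N : ℕ} [NeZero N] {p : α → ℤ × ℤ}
    {R : List (Route α β)} (hcover : Covers R G) (h : IsGridDrawing N p R) : Toroidal G := by
  obtain ⟨hend, hvertices, hroutes, hdisjoint⟩ := h
  obtain ⟨hroute, hpair⟩ := List.nodup_flatMap.1 hroutes
  choose ρ hρR hρedge hρlink using fun e : E(G) => hcover e e.2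
  have hne (e) : (ρ e).steps ≠ [] := (hend _ (hρR e)).1
  have hcell (e) {t : unitInterval} (ht : t ∈ Set.Ioo 0 1) :=
    torusCell_walkCurve_mem_innerCells (N := N) (p := p (ρ e).src) (hne e) ht
  refine ⟨⟨fun x => gridPoint N (p x), fun e => walkCurve N (p (ρ e).src) (ρ e).steps,
    fun x y hxy => Subtype.ext (hvertices ?_),
    fun e => ⟨⟨_, (hρlink e).left_mem⟩, ⟨_, (hρlink e).right_mem⟩, hρlink e,
      walkCurve_zero (hne e), (walkCurve_one (hne e)).trans (gridPoint_eq (hend _ (hρR e)).2)⟩,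
    fun e => injOn_walkCurve (hne e) (hroute _ (hρR e)),
    fun e t ht x hx => hdisjoint x (List.mem_flatMap.2 ⟨_, hρR e, ?_⟩),
    fun e e' hee s hs t ht hst => ?_⟩⟩
  · simpa only [torusCell_gridPoint] using congrArg (torusCell N) hxy
  · simpa only [hx, torusCell_gridPoint] using hcell e ht
  · have : Std.Symm (Function.onFun List.Disjoint fun r : Route α β =>
        innerCells N (p r.src) r.steps) := ⟨fun _ _ h => h.symm⟩
    refine hpair.forall (hρR e) (hρR e') (fun heq => hee (Subtype.ext ?_)) (hcell e hs)
      (hst ▸ hcell e' ht)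
    rw [← hρedge e, heq, hρedge e']

/-- The routes of the edges outside `F`, in a graph with two new vertices and with the new edges
that `new` draws. -/
def rebuildRoutes {κ : Type*} (R : List (Route α β)) (F : Set β) [DecidablePred (· ∈ F)]
    (new : List (Route (α ⊕ Fin 2) (β ⊕ κ))) : List (Route (α ⊕ Fin 2) (β ⊕ κ)) :=
  (R.filter (·.edge ∉ F)).map (fun r => ⟨.inl r.edge, .inl r.src, .inl r.tgt, r.steps⟩) ++ new

variable {G : Graph α β} {R : List (Route α β)}

lemma Covers.rebuild {κ : Type*} (hR : Covers R G) {F : Set β} [DecidablePred (· ∈ F)]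
    {f : κ → Sym2 (α ⊕ Fin 2)} {new : List (Route (α ⊕ Fin 2) (β ⊕ κ))}
    (hnew : ∀ k, ∃ r ∈ new, r.edge = .inr k ∧ f k = s(r.src, r.tgt)) :
    Covers (rebuildRoutes R F new) (CubicTorus.rebuild G F f) := by
  rintro _ (⟨e, ⟨he, heF⟩, rfl⟩ | ⟨k, rfl⟩)
  · obtain ⟨r, hr, rfl, hlink⟩ := hR e he
    exact ⟨_, List.mem_append_left _ (List.mem_map.2 ⟨r, by simpa [hr] using heF, rfl⟩), rfl, heF,
      _, _, hlink, rfl, rfl⟩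
  · obtain ⟨r, hr, hedge, hf⟩ := hnew k
    exact ⟨r, List.mem_append_right _ hr, hedge, hf⟩

variable [DecidableEq β] {N : ℕ} [NeZero N] {p : α → ℤ × ℤ}

theorem toroidal_addLoop (hR : Covers R G) (r : Route α β) (i : ℕ) (toLoop loop : List Step)
    (h : IsGridDrawing N
      (Sum.elim p ![walk (p r.src) r.steps i,
        walk (walk (p r.src) r.steps i) toLoop toLoop.length])
      (rebuildRoutes R {r.edge} [⟨.inr 0, .inl r.src, .inr 0, r.steps.take i⟩,
        ⟨.inr 1, .inr 0, .inl r.tgt, r.steps.drop i⟩, ⟨.inr 2, .inr 0, .inr 1, toLoop⟩,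
        ⟨.inr (3 : Fin 4), .inr 1, .inr 1, loop⟩])) :
    Toroidal (addLoop G r.edge r.src r.tgt) := by
  refine toroidal_of_isGridDrawing (hR.rebuild fun k => ?_) h
  fin_cases k <;> simp

theorem toroidal_addParallel (hR : Covers R G) (r : Route α β) (i j : ℕ) (parallel : List Step)
    (h : IsGridDrawing N
      (Sum.elim p ![walk (p r.src) r.steps i, walk (p r.src) r.steps (i + j)])
      (rebuildRoutes R {r.edge} [⟨.inr 0, .inl r.src, .inr 0, r.steps.take i⟩,
        ⟨.inr 1, .inr 0, .inr 1, (r.steps.drop i).take j⟩,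
        ⟨.inr 2, .inr 1, .inl r.tgt, r.steps.drop (i + j)⟩,
        ⟨.inr (3 : Fin 4), .inr 0, .inr 1, parallel⟩])) :
    Toroidal (addParallel G r.edge r.src r.tgt) := by
  refine toroidal_of_isGridDrawing (hR.rebuild fun k => ?_) h
  fin_cases k <;> simp

theorem toroidal_addChord (hR : Covers R G) (r : Route α β) (i : ℕ) (r' : Route α β) (j : ℕ)
    (chord : List Step)
    (h : IsGridDrawing N
      (Sum.elim p ![walk (p r.src) r.steps i, walk (p r'.src) r'.steps j])
      (rebuildRoutes R {r.edge, r'.edge} [⟨.inr 0, .inl r.src, .inr 0, r.steps.take i⟩,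
        ⟨.inr 1, .inr 0, .inl r.tgt, r.steps.drop i⟩,
        ⟨.inr 2, .inl r'.src, .inr 1, r'.steps.take j⟩,
        ⟨.inr 3, .inr 1, .inl r'.tgt, r'.steps.drop j⟩,
        ⟨.inr (4 : Fin 5), .inr 0, .inr 1, chord⟩])) :
    Toroidal (addChord G r.edge r.src r.tgt r'.edge r'.src r'.tgt) := by
  refine toroidal_of_isGridDrawing (hR.rebuild fun k => ?_) h
  fin_cases k <;> simp

end Drawing

/-! ### Isomorphisms, cycles and girth -/

section Isomorphism

variable {α β α' β' α'' β'' : Type*} {G : Graph α β} {H : Graph α' β'} {K : Graph α'' β''}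

lemma IsIsomorphic.trans (h : IsIsomorphic G H) (h' : IsIsomorphic H K) : IsIsomorphic G K := by
  obtain ⟨φ, ψ, h⟩ := h
  obtain ⟨φ', ψ', h'⟩ := h'
  exact ⟨φ.trans φ', ψ.trans ψ', fun e x y => (h e x y).trans (h' _ _ _)⟩

lemma Toroidal.of_isIsomorphic (hH : Toroidal H) (h : IsIsomorphic G H) : Toroidal G := by
  obtain ⟨φ, ψ, h⟩ := h
  obtain ⟨D⟩ := hH
  refine ⟨⟨fun x => D.point (φ x), fun e => D.curve (ψ e), D.point_injective.comp φ.injective,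
    fun e => ?_, fun e => D.curve_injOn _, fun e t ht x => D.curve_ne_point _ t ht _,
    fun e e' hee => D.curve_ne_curve _ _ (ψ.injective.ne hee)⟩⟩
  obtain ⟨x, y, hxy, hx, hy⟩ := D.curve_ends (ψ e)
  exact ⟨φ.symm x, φ.symm y, (h _ _ _).2 (by simpa using hxy), by simpa using hx, by simpa using hy⟩

lemma HasCycle.of_isIsomorphic {n : ℕ} (hH : HasCycle H n) (h : IsIsomorphic G H) :
    HasCycle G n := by
  obtain ⟨φ, ψ, h⟩ := h
  obtain ⟨v, ε, hv, hε, hlink⟩ := hH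
  refine ⟨fun i => φ.symm ⟨v i, (hlink i).left_mem⟩, fun i => ψ.symm ⟨ε i, (hlink i).edge_mem⟩,
    fun i j hij => hv ?_, fun i j hij => hε ?_, fun i => (h _ _ _).2 ?_⟩
  · simpa using φ.symm.injective (Subtype.ext hij)
  · simpa using ψ.symm.injective (Subtype.ext hij)
  · simpa using hlink i

lemma HasCycle.girth_le {n : ℕ} (h : HasCycle G n) (hn : 1 ≤ n) : girth G ≤ n :=
  iInf₂_le n ⟨hn, h⟩

/-- The bijections `a` and `b`, of the types of all possible vertices and edges, restrict to an
isomorphism from `G` to `H`. -/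
structure IsIsoMap (G : Graph α β) (H : Graph α' β') (a : α ≃ α') (b : β ≃ β') : Prop where
  mem_vertexSet_iff : ∀ x, x ∈ V(G) ↔ a x ∈ V(H)
  isLink_iff : ∀ e x y, G.IsLink e x y ↔ H.IsLink (b e) (a x) (a y)

variable {a : α ≃ α'} {b : β ≃ β'}

lemma IsIsoMap.refl (G : Graph α β) : IsIsoMap G G (.refl α) (.refl β) :=
  ⟨fun _ => .rfl, fun _ _ _ => .rfl⟩

lemma IsIsoMap.trans {a' : α' ≃ α''} {b' : β' ≃ β''} (h : IsIsoMap G H a b)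
    (h' : IsIsoMap H K a' b') : IsIsoMap G K (a.trans a') (b.trans b') :=
  ⟨fun x => (h.mem_vertexSet_iff x).trans (h'.mem_vertexSet_iff _),
    fun e x y => (h.isLink_iff e x y).trans (h'.isLink_iff _ _ _)⟩

lemma IsIsoMap.mem_edgeSet_iff (h : IsIsoMap G H a b) (e : β) : e ∈ E(G) ↔ b e ∈ E(H) := by
  rw [G.edge_mem_iff_exists_isLink, H.edge_mem_iff_exists_isLink, ← a.exists_congr_right]
  simp only [h.isLink_iff, ← a.exists_congr_right (q := fun y => H.IsLink _ _ y)]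

lemma IsIsoMap.isIsomorphic (h : IsIsoMap G H a b) : IsIsomorphic G H :=
  ⟨a.subtypeEquiv h.mem_vertexSet_iff, b.subtypeEquiv h.mem_edgeSet_iff,
    fun e x y => h.isLink_iff e x y⟩

lemma IsIsoMap.rebuild {κ κ' : Type*} (h : IsIsoMap G H a b) (c : Equiv.Perm (Fin 2)) (π : κ ≃ κ')
    {F : Set β} {F' : Set β'} {f : κ → Sym2 (α ⊕ Fin 2)} {f' : κ' → Sym2 (α' ⊕ Fin 2)}
    (hF : ∀ e, e ∈ F ↔ b e ∈ F') (hf : ∀ k, f' (π k) = (f k).map (a.sumCongr c)) :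
    IsIsoMap (CubicTorus.rebuild G F f) (CubicTorus.rebuild H F' f') (a.sumCongr c)
      (b.sumCongr π) where
  mem_vertexSet_iff p := by
    have hnew : (∃ k, p ∈ f k) ↔ ∃ k, a.sumCongr c p ∈ f' k := by
      rw [← π.exists_congr_right]
      simp only [hf, Sym2.mem_map, EmbeddingLike.apply_eq_iff_eq, exists_eq_right]
    change (_ ∨ _) ∨ _ ↔ (_ ∨ _) ∨ _
    refine or_congr (or_congr ?_ ?_) hnew <;> rcases p with x | i <;> simp [h.mem_vertexSet_iff]
  isLink_iff := by
    rintro (e | k) p q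
    · refine and_congr (not_congr (hF e)) ?_
      rcases p with x | i <;> rcases q with y | j <;> simp [h.isLink_iff]
    · change f k = s(p, q) ↔ f' (π k) = s(a.sumCongr c p, a.sumCongr c q)
      rw [hf, ← Sym2.map_mk, (Sym2.map.injective (a.sumCongr c).injective).eq_iff]

/-- The edges of `G` are the elements of `S`, and the ends of an edge are those that `ends`
prescribes. For explicit finite graphs this makes isomorphisms a finite check. -/
def HasEnds (G : Graph α β) (S : Finset β) (ends : β → Sym2 α) : Prop :=
  ∀ e x y, G.IsLink e x y ↔ e ∈ S ∧ ends e = s(x, y)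

lemma HasEnds.rebuild {κ : Type*} [Fintype κ] {S : Finset β} {ends : β → Sym2 α}
    (h : HasEnds G S ends) (F : Set β) [DecidablePred (· ∈ F)] (f : κ → Sym2 (α ⊕ Fin 2)) :
    HasEnds (CubicTorus.rebuild G F f) ({e ∈ S | e ∉ F}.disjSum Finset.univ)
      (Sum.elim (fun e => (ends e).map Sum.inl) f) := by
  rintro (e | k) p q
  · have hmap : (ends e).map Sum.inl = s(p, q) ↔
        ∃ x y, ends e = s(x, y) ∧ p = Sum.inl x ∧ q = Sum.inl y := by
      induction ends e with | h x y =>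
      rcases p with p | i <;> rcases q with q | j <;> simp [eq_comm]
    change e ∉ F ∧ (∃ x y, G.IsLink e x y ∧ p = Sum.inl x ∧ q = Sum.inl y) ↔ _
    simp only [h e, Finset.inl_mem_disjSum, Finset.mem_filter, Sum.elim_inl, hmap, and_assoc,
      exists_and_left]
    tauto
  · change f k = s(p, q) ↔ _
    simp

lemma HasEnds.isIsoMap {S : Finset β} {S' : Finset β'} {ends : β → Sym2 α} {ends' : β' → Sym2 α'}
    (hG : HasEnds G S ends) (hH : HasEnds H S' ends') (hV : ∀ x, x ∈ V(G) ↔ a x ∈ V(H))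
    (hcard : S'.card ≤ S.card) (hends : ∀ e ∈ S, b e ∈ S' ∧ ends' (b e) = (ends e).map a) :
    IsIsoMap G H a b := by
  have hsurj := Finset.surjOn_of_injOn_of_card_le b (fun e he => (hends e he).1)
    b.injective.injOn hcard
  have hmem (e) : e ∈ S ↔ b e ∈ S' := by
    refine ⟨fun he => (hends e he).1, fun he => ?_⟩
    obtain ⟨e', he', heq⟩ := hsurj he
    exact b.injective heq ▸ he'
  refine ⟨hV, fun e x y => ?_⟩
  rw [hG, hH, ← hmem]
  refine and_congr_right fun he => ?_
  rw [(hends e he).2, ← Sym2.map_mk, (Sym2.map.injective a.injective).eq_iff]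

end Isomorphism

section EdgeAddition

variable {α β α' β' : Type*} {G : Graph α β} {H : Graph α' β'} {a : α ≃ α'} {b : β ≃ β'}
  {e e₁ e₂ : β} {x y x₁ y₁ x₂ y₂ : α} {x' y' x₁' y₁' x₂' y₂' : α'}

lemma IsIsoMap.addLoop (h : IsIsoMap G H a b) (hG : G.IsLink e x y) (hH : H.IsLink (b e) x' y') :
    IsIsomorphic (addLoop G e x y) (addLoop H (b e) x' y') := by
  rcases ((h.isLink_iff e x y).1 hG).eq_and_eq_or_eq_and_eq hH with ⟨rfl, rfl⟩ | ⟨rfl, rfl⟩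
  · refine (h.rebuild (.refl _) (.refl _) (by simp) fun k => ?_).isIsomorphic
    fin_cases k <;> rfl
  · refine (h.rebuild (.refl _) (.swap 0 1) (by simp) fun k => ?_).isIsomorphic
    fin_cases k <;> first | rfl | exact Sym2.eq_swap

lemma IsIsoMap.addParallel (h : IsIsoMap G H a b) (hG : G.IsLink e x y)
    (hH : H.IsLink (b e) x' y') :
    IsIsomorphic (addParallel G e x y) (addParallel H (b e) x' y') := by
  rcases ((h.isLink_iff e x y).1 hG).eq_and_eq_or_eq_and_eq hH with ⟨rfl, rfl⟩ | ⟨rfl, rfl⟩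
  · refine (h.rebuild (.refl _) (.refl _) (by simp) fun k => ?_).isIsomorphic
    fin_cases k <;> rfl
  · refine (h.rebuild (.swap 0 1) (.swap 0 2) (by simp) fun k => ?_).isIsomorphic
    fin_cases k <;> first | rfl | exact Sym2.eq_swap

lemma IsIsoMap.addChord (h : IsIsoMap G H a b) (hG₁ : G.IsLink e₁ x₁ y₁)
    (hG₂ : G.IsLink e₂ x₂ y₂) (hH₁ : H.IsLink (b e₁) x₁' y₁') (hH₂ : H.IsLink (b e₂) x₂' y₂') :
    IsIsomorphic (addChord G e₁ x₁ y₁ e₂ x₂ y₂) (addChord H (b e₁) x₁' y₁' (b e₂) x₂' y₂') := by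
  have hF (e) : e ∈ ({e₁, e₂} : Set β) ↔ b e ∈ ({b e₁, b e₂} : Set β') := by simp
  rcases ((h.isLink_iff _ _ _).1 hG₁).eq_and_eq_or_eq_and_eq hH₁ with ⟨rfl, rfl⟩ | ⟨rfl, rfl⟩ <;>
    rcases ((h.isLink_iff _ _ _).1 hG₂).eq_and_eq_or_eq_and_eq hH₂ with ⟨rfl, rfl⟩ | ⟨rfl, rfl⟩
  · exact (h.rebuild (.refl _) (.refl _) hF fun k => by fin_cases k <;> rfl).isIsomorphic
  · exact (h.rebuild (.refl _) (.swap 2 3) hF fun k => by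
      fin_cases k <;> first | rfl | exact Sym2.eq_swap).isIsomorphic
  · exact (h.rebuild (.refl _) (.swap 0 1) hF fun k => by
      fin_cases k <;> first | rfl | exact Sym2.eq_swap).isIsomorphic
  · exact (h.rebuild (.refl _) (.swap 0 1 * .swap 2 3) hF fun k => by
      fin_cases k <;> first | rfl | exact Sym2.eq_swap).isIsomorphic

variable (G) in
lemma addChord_comm (e₁ : β) (x₁ y₁ : α) (e₂ : β) (x₂ y₂ : α) :
    IsIsomorphic (addChord G e₁ x₁ y₁ e₂ x₂ y₂) (addChord G e₂ x₂ y₂ e₁ x₁ y₁) := by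
  refine ((IsIsoMap.refl G).rebuild (.swap 0 1) (.swap 0 2 * .swap 1 3)
    (by simp [or_comm]) fun k => ?_).isIsomorphic
  fin_cases k <;> first | rfl | exact Sym2.eq_swap

variable (G)

lemma hasCycle_addLoop (e : β) (x y : α) : HasCycle (addLoop G e x y) 1 :=
  ⟨fun _ => .inr 1, fun _ => .inr 3, Function.injective_of_subsingleton _,
    Function.injective_of_subsingleton _, fun _ => rfl⟩

lemma hasCycle_addParallel (e : β) (x y : α) : HasCycle (addParallel G e x y) 2 := by
  have hε : Function.Injective (![1, 3] : Fin 2 → Fin 4) := by decide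
  refine ⟨fun i : Fin 2 => .inr i, fun i : Fin 2 => .inr (![1, 3] i), Sum.inr_injective,
    Sum.inr_injective.comp hε, fun (i : Fin 2) => ?_⟩
  fin_cases i
  exacts [rfl, Sym2.eq_swap]

lemma hasCycle_addChord_of_common_end (e₁ : β) (x y₁ : α) (e₂ : β) (y₂ : α) :
    HasCycle (addChord G e₁ x y₁ e₂ x y₂) 3 := by
  have hε : Function.Injective (![0, 4, 2] : Fin 3 → Fin 5) := by decide
  refine ⟨fun i : Fin 3 => ![.inl x, .inr 0, .inr 1] i, fun i : Fin 3 => .inr (![0, 4, 2] i),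
    fun (i j : Fin 3) hij => ?_, Sum.inr_injective.comp hε, fun (i : Fin 3) => ?_⟩
  · fin_cases i <;> fin_cases j <;> first | rfl | simp at hij
  · fin_cases i
    exacts [rfl, rfl, Sym2.eq_swap]

end EdgeAddition

/-! ### The symmetries of `F₁₁` -/

section F11

open F11Vertex

lemma mem_edgeSet_F11 {e : Sym2 F11Vertex} : e ∈ E(F11) ↔ e ∈ F11Edges := by
  have hloop : ∀ z ∈ F11Edges, ¬ z.IsDiag := by decide
  change e ∈ (SimpleGraph.fromEdgeSet (F11Edges : Set (Sym2 F11Vertex))).edgeSet ↔ _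
  rw [SimpleGraph.edgeSet_fromEdgeSet]
  exact and_iff_left_of_imp (hloop e)

lemma hasEnds_F11 : HasEnds F11 F11Edges id := by
  intro e x y
  rw [← mem_edgeSet_F11, and_comm]
  rfl

/-- The bijection of unordered pairs that a bijection of their entries induces. -/
def sym2Equiv {α β : Type*} (g : α ≃ β) : Sym2 α ≃ Sym2 β where
  toFun := Sym2.map g
  invFun := Sym2.map g.symm
  left_inv z := by simp [Sym2.map_map]
  right_inv z := by simp [Sym2.map_map]

lemma sym2Equiv_refl {α : Type*} : sym2Equiv (.refl α) = .refl (Sym2 α) :=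
  Equiv.ext fun z => congrFun Sym2.map_id z

lemma sym2Equiv_trans {α β γ : Type*} (g : α ≃ β) (h : β ≃ γ) :
    sym2Equiv (g.trans h) = (sym2Equiv g).trans (sym2Equiv h) :=
  Equiv.ext fun z => (Sym2.map_map (g := h) (f := g) z).symm

/-- Generators of the group of automorphisms of `F₁₁`. Without the edges `23` and `67`, the graph
falls into two copies of `K₃,₃` minus an edge: one consists of `A`, `A'`, `1`, `2`, `7`, `8`. The
first four generators exchange twins, the fifth one exchanges `23` with `67`, and the last one
exchanges the two copies. -/
def F11Generators : List (Equiv.Perm F11Vertex) :=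
  [.swap A n1, .swap A' n8, .swap B n4, .swap B' n5,
   (Equiv.swap A A').trans <| (Equiv.swap B B').trans <| (Equiv.swap n1 n8).trans <|
    (Equiv.swap n2 n7).trans <| (Equiv.swap n3 n6).trans <| .swap n4 n5,
   (Equiv.swap A B).trans <| (Equiv.swap A' B').trans <| (Equiv.swap n1 n4).trans <|
    (Equiv.swap n2 n3).trans <| (Equiv.swap n5 n8).trans <| .swap n6 n7]

/-- The composites of the sublists of `F11Generators`. -/
def F11Symmetries : List (Equiv.Perm F11Vertex) :=
  F11Generators.sublists.map (List.foldr Equiv.trans (.refl _))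

lemma isIsoMap_of_mem_F11Generators :
    ∀ g ∈ F11Generators, IsIsoMap F11 F11 g (sym2Equiv g) := by
  have hmaps : ∀ g ∈ F11Generators, ∀ z ∈ F11Edges, sym2Equiv g z ∈ F11Edges := by
    simp only [F11Generators, List.forall_mem_cons, List.not_mem_nil, false_imp_iff, implies_true,
      and_true]
    decide +kernel
  exact fun g hg => hasEnds_F11.isIsoMap hasEnds_F11 (fun _ => .rfl) le_rfl
    fun z hz => ⟨hmaps g hg z hz, rfl⟩

lemma isIsoMap_of_mem_F11Symmetries {g : Equiv.Perm F11Vertex} (hg : g ∈ F11Symmetries) :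
    IsIsoMap F11 F11 g (sym2Equiv g) := by
  obtain ⟨l, hl, rfl⟩ := List.mem_map.1 hg
  have hgen : ∀ g ∈ l, IsIsoMap F11 F11 g (sym2Equiv g) := fun g hg =>
    isIsoMap_of_mem_F11Generators g ((List.mem_sublists.1 hl).subset hg)
  clear hg hl
  induction l with
  | nil =>
    rw [List.foldr_nil, sym2Equiv_refl]
    exact .refl F11
  | cons g l ih =>
    rw [List.foldr_cons, sym2Equiv_trans]
    exact (hgen g (.head _)).trans (ih fun h hh => hgen h (.tail _ hh))

/-- Representatives of the edges up to symmetry. -/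
def edgeReps : List (F11Vertex × F11Vertex) :=
  [(B', n4), (n7, A'), (n7, n6)]

/-- Representatives of the pairs of disjoint edges up to symmetry. -/
def disjointPairs : List ((F11Vertex × F11Vertex) × (F11Vertex × F11Vertex)) :=
  [((A, A'), (B, B')), ((A, A'), (B, n3)), ((A, A'), (n1, n2)), ((A, A'), (n2, n3)),
   ((A, A'), (n1, n8)), ((A, n2), (A', n7)), ((A, n2), (B, n3)), ((A, n2), (B', n6)),
   ((A, n2), (n6, n7)), ((n2, n3), (n6, n7))]

/-- Representatives of the pairs of distinct edges with a common end up to symmetry; the common end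
comes first in both edges. -/
def adjacentPairs : List ((F11Vertex × F11Vertex) × (F11Vertex × F11Vertex)) :=
  [((A, A'), (A, n8)), ((A, A'), (A, n2)), ((n7, A'), (n7, n8)), ((n7, A'), (n7, n6))]

lemma exists_symmetry_edge : ∀ z ∈ F11Edges, ∃ g ∈ F11Symmetries, ∃ r ∈ edgeReps,
    sym2Equiv g z = s(r.1, r.2) := by
  decide +kernel

/-- The edges `z` and `z'` are, in one of the two orders, the edges of the pair `q`. -/
def IsEdgePair (z z' : Sym2 F11Vertex) (q : (F11Vertex × F11Vertex) × (F11Vertex × F11Vertex)) :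
    Prop :=
  z = s(q.1.1, q.1.2) ∧ z' = s(q.2.1, q.2.2) ∨ z = s(q.2.1, q.2.2) ∧ z' = s(q.1.1, q.1.2)

instance (z z' : Sym2 F11Vertex) (q : (F11Vertex × F11Vertex) × (F11Vertex × F11Vertex)) :
    Decidable (IsEdgePair z z' q) :=
  inferInstanceAs (Decidable (_ ∨ _))

lemma exists_symmetry_edgePair : ∀ r ∈ edgeReps, ∀ z ∈ F11Edges, s(r.1, r.2) ≠ z →
    ∃ g ∈ F11Symmetries, ∃ q ∈ disjointPairs ++ adjacentPairs,
      IsEdgePair (sym2Equiv g s(r.1, r.2)) (sym2Equiv g z) q := by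
  decide +kernel

variable {e e' : Sym2 F11Vertex} {x y x' y' : F11Vertex}

lemma exists_isIsoMap_edge (he : e ∈ E(F11)) :
    ∃ g, IsIsoMap F11 F11 g (sym2Equiv g) ∧ ∃ r ∈ edgeReps, sym2Equiv g e = s(r.1, r.2) := by
  obtain ⟨g, hg, hr⟩ := exists_symmetry_edge e (mem_edgeSet_F11.1 he)
  exact ⟨g, isIsoMap_of_mem_F11Symmetries hg, hr⟩

lemma exists_isIsoMap_edgePair (he : e ∈ E(F11)) (he' : e' ∈ E(F11)) (hne : e ≠ e') :
    ∃ g, IsIsoMap F11 F11 g (sym2Equiv g) ∧ ∃ q ∈ disjointPairs ++ adjacentPairs,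
      IsEdgePair (sym2Equiv g e) (sym2Equiv g e') q := by
  obtain ⟨g, hg, r, hr, hge⟩ := exists_isIsoMap_edge he
  obtain ⟨h, hh, q, hq, hpair⟩ := exists_symmetry_edgePair r hr (sym2Equiv g e')
    (mem_edgeSet_F11.1 <| (hg.mem_edgeSet_iff e').1 he') (hge ▸ (sym2Equiv g).injective.ne hne)
  refine ⟨g.trans h, sym2Equiv_trans g h ▸ hg.trans (isIsoMap_of_mem_F11Symmetries hh), q, hq, ?_⟩
  rw [sym2Equiv_trans, Equiv.trans_apply, Equiv.trans_apply, hge]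
  exact hpair

lemma exists_isIsomorphic_F11Chord (h : F11.IsLink e x y) (h' : F11.IsLink e' x' y')
    (hne : e ≠ e') : ∃ q ∈ disjointPairs ++ adjacentPairs,
      IsIsomorphic (addChord F11 e x y e' x' y') (F11Chord q.1.1 q.1.2 q.2.1 q.2.2) := by
  obtain ⟨g, hg, q, hq, hpair⟩ := exists_isIsoMap_edgePair h.edge_mem h'.edge_mem hne
  have hmem := (hg.mem_edgeSet_iff e).1 h.edge_mem
  have hmem' := (hg.mem_edgeSet_iff e').1 h'.edge_mem
  refine ⟨q, hq, ?_⟩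
  rcases hpair with ⟨heq, heq'⟩ | ⟨heq, heq'⟩
  · have hiso := hg.addChord h h' ⟨heq, hmem⟩ ⟨heq', hmem'⟩
    rwa [heq, heq'] at hiso
  · have hiso := hg.addChord h h' ⟨heq, hmem⟩ ⟨heq', hmem'⟩
    rw [heq, heq'] at hiso
    exact hiso.trans (addChord_comm ..)

/-- The bijection of vertices that turns `F₁₁ ∪ (A2 - A'7)` into `F₁₁ ∪ (AA' - 18)`. -/
def exceptionalVertexMap : Equiv.Perm (F11Vertex ⊕ Fin 2) :=
  [.inr 0, .inl n1, .inl A, .inr 1, .inl A'].formPerm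

/-- The bijection of edges that goes with `exceptionalVertexMap`. -/
def exceptionalEdgeMap : Equiv.Perm (Sym2 F11Vertex ⊕ Fin 5) :=
  (List.formPerm [.inl s(A, A'), .inr 4, .inl s(A', n1), .inr 0, .inr 2, .inr 1, .inl s(n1, n2),
    .inl s(A, n2)]).trans
  (List.formPerm [.inl s(n1, n8), .inl s(A, n8), .inr 3, .inl s(A', n7)])

lemma isIsomorphic_F11Chord_H1 : IsIsomorphic (F11Chord A n2 A' n7) H1 := by
  have hV {κ : Type} {F : Set (Sym2 F11Vertex)} {f : κ → Sym2 (F11Vertex ⊕ Fin 2)} (p) :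
      p ∈ V(rebuild F11 F f) := by
    rcases p with x | i
    exacts [.inl (.inl ⟨x, trivial, rfl⟩), .inl (.inr ⟨i, rfl⟩)]
  have hends : HasEnds (F11Chord A n2 A' n7) _ _ := hasEnds_F11.rebuild _ _
  have hends' : HasEnds H1 _ _ := hasEnds_F11.rebuild _ _
  exact (hends.isIsoMap hends' (fun p => iff_of_true (hV p) (hV _)) (a := exceptionalVertexMap)
    (b := exceptionalEdgeMap) (by decide +kernel) (by decide +kernel)).isIsomorphic

/-! ### A drawing of `F₁₁` on the torus -/

/-- The positions of the vertices of `F₁₁` in the `10 × 10` grid. -/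
def position : F11Vertex → ℤ × ℤ
  | n1 => (2, 0) | n2 => (4, 0) | n3 => (6, 0) | n4 => (8, 0)
  | n8 => (2, 2) | A => (4, 2) | B => (6, 2) | n5 => (8, 2)
  | n7 => (2, 4) | B' => (6, 4) | n6 => (8, 4) | A' => (2, 8)

open Step in
/-- The steps of the walk that draws the edge of `F₁₁` from the first to the second vertex. -/
def edgeSteps : F11Vertex → F11Vertex → List Step
  | A, A' => [up, up, up, up, up, up, left, left]
  | B', n4 => [up, up, up, up, right, right, up, up]
  | n7, A' => [up, up, up, up]
  | n7, n6 => [left, left, left, left]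
  | B, B' | A', n1 | n4, n5 | n1, n8 | n5, n6 => [up, up]
  | A, n2 | B, n3 | n7, n8 => [down, down]
  | A, n8 => [left, left]
  | B, n5 | B', n6 | n1, n2 | n3, n4 | n2, n3 => [right, right]
  | _, _ => []

/-- The walk in the grid that draws the edge of `F₁₁` from `x` to `y`. -/
def F11Route (x y : F11Vertex) : Route F11Vertex (Sym2 F11Vertex) :=
  ⟨s(x, y), x, y, edgeSteps x y⟩

/-- The drawing of the eighteen edges of `F₁₁`. -/
def F11Routes : List (Route F11Vertex (Sym2 F11Vertex)) :=
  [F11Route A A', F11Route B B', F11Route A n8, F11Route A' n1, F11Route B n5, F11Route B' n4,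
   F11Route n4 n5, F11Route n1 n8, F11Route A n2, F11Route n7 A', F11Route B n3, F11Route B' n6,
   F11Route n1 n2, F11Route n3 n4, F11Route n5 n6, F11Route n7 n8, F11Route n2 n3,
   F11Route n7 n6]

lemma covers_F11Routes : Covers F11Routes F11 := by
  have hroute : ∀ z ∈ F11Edges, ∃ r ∈ F11Routes, r.edge = z ∧ z = s(r.src, r.tgt) := by
    decide +kernel
  intro e he
  obtain ⟨r, hr, hedge, hends⟩ := hroute e (mem_edgeSet_F11.1 he)
  exact ⟨r, hr, hedge, hends, he⟩

open Step in
lemma toroidal_addLoop_edgeReps :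
    ∀ r ∈ edgeReps, Toroidal (addLoop F11 s(r.1, r.2) r.1 r.2) := by
  have h := toroidal_addLoop (N := 10) (p := position) covers_F11Routes
  simp only [edgeReps, List.forall_mem_cons, List.not_mem_nil, false_imp_iff, implies_true,
    and_true]
  exact ⟨h (F11Route B' n4) 2 [right] [right, up, left, down] (by decide +kernel),
    h (F11Route n7 A') 1 [left] [left, up, right, down] (by decide +kernel),
    h (F11Route n7 n6) 3 [up] [right, up, left, down] (by decide +kernel)⟩

open Step in
lemma toroidal_addParallel_edgeReps :
    ∀ r ∈ edgeReps, Toroidal (addParallel F11 s(r.1, r.2) r.1 r.2) := by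
  have h := toroidal_addParallel (N := 10) (p := position) covers_F11Routes
  simp only [edgeReps, List.forall_mem_cons, List.not_mem_nil, false_imp_iff, implies_true,
    and_true]
  exact ⟨h (F11Route B' n4) 1 2 [right, up, up, left] (by decide +kernel),
    h (F11Route n7 A') 1 2 [right, up, up, left] (by decide +kernel),
    h (F11Route n7 n6) 1 2 [up, left, left, down] (by decide +kernel)⟩

open Step in
lemma toroidal_or_exceptional_disjointPairs : ∀ q ∈ disjointPairs,
    Toroidal (F11Chord q.1.1 q.1.2 q.2.1 q.2.2) ∨
      ∃ H ∈ [H1, H2, H3, H4], IsIsomorphic (F11Chord q.1.1 q.1.2 q.2.1 q.2.2) H := by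
  have h := toroidal_addChord (N := 10) (p := position) covers_F11Routes
  have hH (H) (hH : H ∈ [H1, H2, H3, H4]) : ∃ H' ∈ [H1, H2, H3, H4], IsIsomorphic H H' :=
    ⟨H, hH, (IsIsoMap.refl H).isIsomorphic⟩
  simp only [disjointPairs, List.forall_mem_cons, List.not_mem_nil, false_imp_iff, implies_true,
    and_true]
  exact ⟨.inl (h (F11Route A A') 1 (F11Route B B') 1 [right, right] (by decide +kernel)),
    .inl (h (F11Route A A') 1 (F11Route B n3) 1 [right, down, down, right] (by decide +kernel)),
    .inl (h (F11Route A A') 7 (F11Route n1 n2) 1 [up, up] (by decide +kernel)),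
    .inl (h (F11Route A A') 6 (F11Route n2 n3) 1 [right, up, up] (by decide +kernel)),
    .inr (hH H1 (by simp)), .inr ⟨H1, by simp, isIsomorphic_F11Chord_H1⟩,
    .inl (h (F11Route A n2) 1 (F11Route B n3) 1 [right, right] (by decide +kernel)),
    .inr (hH H4 (by simp)), .inr (hH H2 (by simp)), .inr (hH H3 (by simp))⟩

open Step in
lemma toroidal_adjacentPairs :
    ∀ q ∈ adjacentPairs, Toroidal (F11Chord q.1.1 q.1.2 q.2.1 q.2.2) := by
  have h := toroidal_addChord (N := 10) (p := position) covers_F11Routes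
  simp only [adjacentPairs, List.forall_mem_cons, List.not_mem_nil, false_imp_iff, implies_true,
    and_true]
  exact ⟨h (F11Route A A') 1 (F11Route A n8) 1 [left, down] (by decide +kernel),
    h (F11Route A A') 1 (F11Route A n2) 1 [right, down, down, left] (by decide +kernel),
    h (F11Route n7 A') 1 (F11Route n7 n8) 1 [right, down, down, left] (by decide +kernel),
    h (F11Route n7 A') 1 (F11Route n7 n6) 1 [left, down] (by decide +kernel)⟩

lemma hasCycle_adjacentPairs :
    ∀ q ∈ adjacentPairs, HasCycle (F11Chord q.1.1 q.1.2 q.2.1 q.2.2) 3 := by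
  have hend : ∀ q ∈ adjacentPairs, q.1.1 = q.2.1 := by simp [adjacentPairs]
  intro q hq
  rw [← hend q hq]
  exact hasCycle_addChord_of_common_end ..

lemma F11Chord_mem_F11Cases :
    ∀ q ∈ disjointPairs, F11Chord q.1.1 q.1.2 q.2.1 q.2.2 ∈ F11Cases := by
  have hcases : F11Cases = disjointPairs.map fun q => F11Chord q.1.1 q.1.2 q.2.1 q.2.2 := rfl
  exact fun q hq => hcases ▸ List.mem_map_of_mem hq

theorem toroidal_addLoop_F11 (h : F11.IsLink e x y) : Toroidal (addLoop F11 e x y) := by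
  obtain ⟨g, hg, r, hr, heq⟩ := exists_isIsoMap_edge h.edge_mem
  have hiso := hg.addLoop h ⟨heq, (hg.mem_edgeSet_iff e).1 h.edge_mem⟩
  rw [heq] at hiso
  exact (toroidal_addLoop_edgeReps r hr).of_isIsomorphic hiso

theorem toroidal_addParallel_F11 (h : F11.IsLink e x y) : Toroidal (addParallel F11 e x y) := by
  obtain ⟨g, hg, r, hr, heq⟩ := exists_isIsoMap_edge h.edge_mem
  have hiso := hg.addParallel h ⟨heq, (hg.mem_edgeSet_iff e).1 h.edge_mem⟩
  rw [heq] at hiso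
  exact (toroidal_addParallel_edgeReps r hr).of_isIsomorphic hiso

end F11

end CubicTorus

theorem mainTheorem6 {α β : Type*} (K : Graph α β)
    (hK : CubicTorus.IsEdgeAddition CubicTorus.F11 K) :
    ((¬ ∃ H ∈ [CubicTorus.H1, CubicTorus.H2, CubicTorus.H3, CubicTorus.H4],
        CubicTorus.IsIsomorphic K H) → CubicTorus.Toroidal K) ∧
    (4 ≤ CubicTorus.girth K → ∃ H ∈ CubicTorus.F11Cases, CubicTorus.IsIsomorphic K H) := by
  open CubicTorus in
  have hgirth {n : ℕ} (hpos : 1 ≤ n) (hlt : n < 4) (hcycle : HasCycle K n) : ¬ 4 ≤ girth K :=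
    fun h4 => hlt.not_ge (by exact_mod_cast h4.trans (hcycle.girth_le hpos))
  rcases hK with ⟨e, x, y, he, hiso⟩ | ⟨e, x, y, he, hiso⟩ |
      ⟨e, x, y, e', x', y', he, he', hne, hiso⟩
  · exact ⟨fun _ => (toroidal_addLoop_F11 he).of_isIsomorphic hiso, fun h4 => absurd h4 <|
      hgirth le_rfl (by norm_num) ((hasCycle_addLoop F11 e x y).of_isIsomorphic hiso)⟩
  · exact ⟨fun _ => (toroidal_addParallel_F11 he).of_isIsomorphic hiso, fun h4 => absurd h4 <|
      hgirth one_le_two (by norm_num) ((hasCycle_addParallel F11 e x y).of_isIsomorphic hiso)⟩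
  obtain ⟨q, hq, hq_iso⟩ := exists_isIsomorphic_F11Chord he he' hne
  replace hiso := hiso.trans hq_iso
  rcases List.mem_append.1 hq with hq | hq
  · refine ⟨fun hnot => ?_, fun _ => ⟨_, F11Chord_mem_F11Cases q hq, hiso⟩⟩
    rcases toroidal_or_exceptional_disjointPairs q hq with htoroidal | ⟨H, hH, hqH⟩
    · exact htoroidal.of_isIsomorphic hiso
    · exact absurd ⟨H, hH, hiso.trans hqH⟩ hnot
  · exact ⟨fun _ => (toroidal_adjacentPairs q hq).of_isIsomorphic hiso, fun h4 => absurd h4 <|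
      hgirth (by norm_num) (by norm_num) ((hasCycle_adjacentPairs q hq).of_isIsomorphic hiso)⟩
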